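/- Let $S$ be a rational $p\times p$ complex matrix function that is a Schur function, i.e. it has no pole in $\Pi^+=\{\mathrm{Re}\, s>0\}$ and $S(s)S(s)^*\le I_p$ for $s\in\Pi^+$. Assume that it is strictly contractive at infinity, $\|S(\infty)\|<1$ (operator norm). Let $S(s)=C(sI_n-A)^{-1}B+D$ be a minimal realization of $S$, that is, a realization by complex matrices with $A$ of the smallest possible size $n\times n$; in particular $D=S(\infty)$. The smallest size of $A$ in a realization of a proper rational matrix is called its McMillan degree. Put $$\hat A=A+BD^*(I_p-DD^*)^{-1}C,\qquad \hat B=B(I_p-D^*D)^{-1/2},\qquad \hat C=(I_p-DD^*)^{-1/2}C .$$ For a Hermitian solution $P$ of the algebraic Riccati equation $$P\hat C^*\hat C P+\hat A P+P\hat A^*+\hat B\hat B^*=0$$ (such a $P$ is automatically invertible) let $$\mathcal S_P(s)=\begin{pmatrix}C_1\\ C\end{pmatrix}(sI_n-A)^{-1}\begin{pmatrix}B_1& B\end{pmatrix}+\begin{pmatrix}-D^*&(I_p-D^*D)^{1/2}\\(I_p-DD^*)^{1/2}&D\end{pmatrix}=\begin{pmatrix}S_{11}&S_{12}\\S_{21}&S\end{pmatrix},$$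 where $$B_1=-(PC^*+BD^*)(I_p-DD^*)^{-1/2},\qquad C_1=-(I_p-D^*D)^{-1/2}(B^*P^{-1}+D^*C),$$ be the (inner) extension of $S$ associated with $P$. **Proposition.** Let $P\neq\widetilde P$ be two Hermitian solutions of the Riccati equation, with associated extensions $\mathcal S_P=\begin{pmatrix}S_{11}&S_{12}\\S_{21}&S\end{pmatrix}$ and $\mathcal S_{\widetilde P}=\begin{pmatrix}\widetilde S_{11}&\widetilde S_{12}\\\widetilde S_{21}&S\end{pmatrix}$. Then $S_{21}$ is invertible as a rational matrix, so that $Q=S_{21}^{-1}\widetilde S_{21}$ is well-defined, and: 1. $Q$ is unitary on the imaginary axis: it has no pole there and $Q(i\omega)Q(i\omega)^*=I_p$ for all $\omega\in\mathbb R$; 2. the McMillan degree of $Q$ is $\operatorname{rank}(\widetilde P-P)$; 3. $Q$ is inner (a Schur function that is unitary on the imaginary axis) if and only if $\widetilde P\ge P$, i.e. $\widetilde P-P$ is positive semidefinite. -/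

import Mathlib

open scoped Matrix MatrixOrder

namespace Darlington

noncomputable section

/-- Pointwise value at `s` of a matrix of rational functions
(meaningful when no entry has a pole at `s`, see `RegularAt`). -/
def evalAt {k m : Type*} (W : Matrix k m (RatFunc ℂ)) (s : ℂ) : Matrix k m ℂ :=
  W.map (RatFunc.eval (RingHom.id ℂ) s)

/-- The rational matrix `W` has no pole at `s`: no reduced denominator of an entry vanishes there. -/
def RegularAt {k m : Type*} (W : Matrix k m (RatFunc ℂ)) (s : ℂ) : Prop :=
  ∀ i j, (W i j).denom.eval s ≠ 0

/-- The transfer function `C (s I - A)⁻¹ B + D`, as a matrix of rational functions of `s`. -/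
def transferFunction {k m ι : Type*} [Fintype ι] [DecidableEq ι]
    (A : Matrix ι ι ℂ) (B : Matrix ι m ℂ) (C : Matrix k ι ℂ) (D : Matrix k m ℂ) :
    Matrix k m (RatFunc ℂ) :=
  C.map RatFunc.C * (Matrix.scalar ι RatFunc.X - A.map RatFunc.C)⁻¹ * B.map RatFunc.C
    + D.map RatFunc.C

/-- `W` has McMillan degree `d`: `d` is the least size of the dynamics matrix of a realization
of `W`. (For a `W` without realization, that is not proper, no `d` qualifies.) -/
def HasMcMillanDegree {k m : Type*} (W : Matrix k m (RatFunc ℂ)) (d : ℕ) : Prop :=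
  IsLeast {n : ℕ | ∃ (A : Matrix (Fin n) (Fin n) ℂ) (B : Matrix (Fin n) m ℂ)
    (C : Matrix k (Fin n) ℂ) (D : Matrix k m ℂ), W = transferFunction A B C D} d

/-- `(A, B, C, D)` is a realization of `W` whose dynamics matrix has the least possible size. -/
def IsMinimalRealization {k m : Type*} {n : ℕ} (A : Matrix (Fin n) (Fin n) ℂ)
    (B : Matrix (Fin n) m ℂ) (C : Matrix k (Fin n) ℂ) (D : Matrix k m ℂ)
    (W : Matrix k m (RatFunc ℂ)) : Prop :=
  W = transferFunction A B C D ∧ HasMcMillanDegree W n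

/-- Rational Schur functions: no pole in the open right half-plane, and `W(s) W(s)* ≤ I` there. -/
def IsSchur {k m : Type*} [Fintype m] [DecidableEq k] (W : Matrix k m (RatFunc ℂ)) : Prop :=
  ∀ s : ℂ, 0 < s.re → RegularAt W s ∧ evalAt W s * (evalAt W s)ᴴ ≤ 1

/-- `W` has no pole on the imaginary axis and `W(iω) W(iω)* = I` for all real `ω`. -/
def UnitaryOnImaginaryAxis {k : Type*} [Fintype k] [DecidableEq k]
    (W : Matrix k k (RatFunc ℂ)) : Prop :=
  ∀ ω : ℝ, RegularAt W (Complex.I * ω) ∧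
    evalAt W (Complex.I * ω) * (evalAt W (Complex.I * ω))ᴴ = 1

/-- Inner (lossless) functions: square rational Schur functions, unitary on the imaginary axis. -/
def IsInner {k : Type*} [Fintype k] [DecidableEq k] (W : Matrix k k (RatFunc ℂ)) : Prop :=
  IsSchur W ∧ UnitaryOnImaginaryAxis W

section Extension

variable {n p : ℕ} (A : Matrix (Fin n) (Fin n) ℂ) (B : Matrix (Fin n) (Fin p) ℂ)
  (C : Matrix (Fin p) (Fin n) ℂ) (D : Matrix (Fin p) (Fin p) ℂ) (P : Matrix (Fin n) (Fin n) ℂ)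

/-- `Â = A + B D* (I - D D*)⁻¹ C`. -/
def hatA : Matrix (Fin n) (Fin n) ℂ := A + B * Dᴴ * (1 - D * Dᴴ)⁻¹ * C

/-- `B̂ = B (I - D* D)^{-1/2}`. -/
def hatB : Matrix (Fin n) (Fin p) ℂ := B * (CFC.sqrt (1 - Dᴴ * D))⁻¹

/-- `Ĉ = (I - D D*)^{-1/2} C`. -/
def hatC : Matrix (Fin p) (Fin n) ℂ := (CFC.sqrt (1 - D * Dᴴ))⁻¹ * C

/-- `P` is a Hermitian solution of the algebraic Riccati equation
`P Ĉ* Ĉ P + Â P + P Â* + B̂ B̂* = 0`. -/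
def IsRiccatiSolution : Prop :=
  P.IsHermitian ∧
    P * (hatC C D)ᴴ * hatC C D * P + hatA A B C D * P + P * (hatA A B C D)ᴴ
      + hatB B D * (hatB B D)ᴴ = 0

/-- `D₂₁ = (I - D D*)^{1/2}`. -/
def D21 : Matrix (Fin p) (Fin p) ℂ := CFC.sqrt (1 - D * Dᴴ)

/-- `D₁₂ = (I - D* D)^{1/2}`. -/
def D12 : Matrix (Fin p) (Fin p) ℂ := CFC.sqrt (1 - Dᴴ * D)

/-- `B₁ = -(P C* + B D*) (I - D D*)^{-1/2}`. -/
def B1 : Matrix (Fin n) (Fin p) ℂ := -((P * Cᴴ + B * Dᴴ) * (D21 D)⁻¹)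

/-- `C₁ = -(I - D* D)^{-1/2} (B* P⁻¹ + D* C)`. -/
def C1 : Matrix (Fin p) (Fin n) ℂ := -((D12 D)⁻¹ * (Bᴴ * P⁻¹ + Dᴴ * C))

/-- The extension `𝒮_P` of `S = C (s I - A)⁻¹ B + D` associated with `P`: the transfer function
with dynamics matrix `A`, input matrix `[B₁ B]`, output matrix `[C₁; C]` and value
`[-D* D₁₂; D₂₁ D]` at infinity. -/
def extension : Matrix (Fin p ⊕ Fin p) (Fin p ⊕ Fin p) (RatFunc ℂ) :=
  transferFunction A (Matrix.fromCols (B1 B C D P) B) (Matrix.fromRows (C1 B C D P) C)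
    (Matrix.fromBlocks (-Dᴴ) (D12 D) (D21 D) D)

/-- The lower left block `S₂₁` of `𝒮_P`. -/
def S21 : Matrix (Fin p) (Fin p) (RatFunc ℂ) := (extension A B C D P).toBlocks₂₁

end Extension

end

end Darlington

/-!
Write `E = (I - D D*)^{1/2}`, `Ĉ = E⁻¹ C`, `F = Â + P Ĉ* Ĉ` and `Δ = P̃ - P`. Since `S₂₁` has the
invertible value `E` at infinity it is invertible, and since `S₂₁` and `S̃₂₁` differ only in
their input matrices, the dynamics of `A` cancel in the quotient
(`transferFunction_mul_quotient`):
`Q = I - Ĉ (s I - F)⁻¹ Δ Ĉ*`. Subtracting the two Riccati equations shows that `Δ` solves the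
homogeneous equation `F Δ + Δ F* + Δ Ĉ* Ĉ Δ = 0` (`riccati_difference`), so that the range of `Δ`
is invariant under `F`. With a compact spectral decomposition `Δ = U Y U*`, where `Y` is
invertible of size `rank Δ`, and with `a = U* F U` and `c = Ĉ U`, this becomes
`Q = I - c (s I - a)⁻¹ Y c*` and `a Y + Y a* + Y c* c Y = 0`.

The pair `(C, A)` is observable as the realization of `S` is minimal. Observability passes to
`(Ĉ, F)`, which is an output injection, to `(c, a)`, which is a restriction to an invariant
subspace, and by the homogeneous equation it gives controllability of `(a, Y c*)`. Hence the
realization of `Q` is minimal (`card_le_of_transferFunction_eq`, a comparison of Hankel maps), so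
the McMillan degree is `rank Δ`, and every eigenvalue of `a` is a pole of `Q`
(`charpoly_eval_ne_zero_of_regularAt`).

The homogeneous equation also gives
`I - Q(s) Q(s)* = 2 Re(s) · c (s I - a)⁻¹ Y (c (s I - a)⁻¹)*` (`evalAt_mul_conjTranspose`), and,
with observability, that `a` has no eigenvalue on the imaginary axis; so `Q` is unitary there.
If `Y > 0` then `a` has no eigenvalue in the right half-plane either, and `Q` is inner. If `Q` is
inner, it has no poles in the closed right half-plane, so `a` is stable, and Lyapunov's theorem
for `a Y + Y a* = -(c Y)* (c Y)` gives `Y ≥ 0` (`posSemidef_of_lyapunov`).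
-/

namespace Darlington

/-! ### Evaluation of rational matrices at a regular point -/

/-- The local ring of rational functions without pole at `s`. -/
def regularSubring (s : ℂ) : Subring (RatFunc ℂ) where
  carrier := {f | f.denom.eval s ≠ 0}
  mul_mem' {f g} hf hg h := by
    have := Polynomial.eval_eq_zero_of_dvd_of_eval_eq_zero (RatFunc.denom_mul_dvd f g) h
    rw [Polynomial.eval_mul] at this
    exact (mul_ne_zero hf hg) this
  add_mem' {f g} hf hg h := by
    have := Polynomial.eval_eq_zero_of_dvd_of_eval_eq_zero (RatFunc.denom_add_dvd f g) h
    rw [Polynomial.eval_mul] at this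
    exact (mul_ne_zero hf hg) this
  one_mem' := by simp
  zero_mem' := by simp
  neg_mem' {f} hf h := by
    have hd : (-f).denom ∣ f.denom := by
      rw [RatFunc.denom_dvd f.denom_ne_zero]
      exact ⟨-f.num, by rw [map_neg, neg_div, RatFunc.num_div_denom]⟩
    exact hf (Polynomial.eval_eq_zero_of_dvd_of_eval_eq_zero hd h)

/-- Evaluation at `s`, as a ring homomorphism on the rational functions without pole at `s`. -/
noncomputable def evalHom (s : ℂ) : regularSubring s →+* ℂ where
  toFun f := RatFunc.eval (RingHom.id ℂ) s f
  map_one' := by simp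
  map_zero' := by simp
  map_mul' f g := RatFunc.eval_mul (RingHom.id ℂ) s f.2 g.2
  map_add' f g := RatFunc.eval_add (RingHom.id ℂ) s f.2 g.2

theorem div_mem_regularSubring {s : ℂ} (f q : Polynomial ℂ) (hq : q.eval s ≠ 0) :
    algebraMap _ (RatFunc ℂ) f / algebraMap _ (RatFunc ℂ) q ∈ regularSubring s := by
  intro h
  have hq0 : q ≠ 0 := by rintro rfl; simp at hq
  exact hq (Polynomial.eval_eq_zero_of_dvd_of_eval_eq_zero
    ((RatFunc.denom_dvd hq0).2 ⟨f, rfl⟩) h)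

theorem algebraMap_mem_regularSubring (s : ℂ) (f : Polynomial ℂ) :
    algebraMap _ (RatFunc ℂ) f ∈ regularSubring s := by
  simpa using div_mem_regularSubring (s := s) f 1 (by simp)

theorem C_mem_regularSubring (s z : ℂ) : RatFunc.C z ∈ regularSubring s := by
  rw [← RatFunc.algebraMap_C]; exact algebraMap_mem_regularSubring s _

theorem X_mem_regularSubring (s : ℂ) : RatFunc.X ∈ regularSubring s := by
  rw [← RatFunc.algebraMap_X]; exact algebraMap_mem_regularSubring s _

section Matrices

variable {k l m ι : Type*} {s : ℂ}

theorem RegularAt.exists_lift {W : Matrix k m (RatFunc ℂ)} (h : RegularAt W s) :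
    ∃ W' : Matrix k m (regularSubring s), W = W'.map (regularSubring s).subtype :=
  ⟨fun i j => ⟨W i j, h i j⟩, rfl⟩

theorem regularAt_map_subtype (W : Matrix k m (regularSubring s)) :
    RegularAt (W.map (regularSubring s).subtype) s := fun i j => (W i j).2

theorem evalAt_map_subtype (W : Matrix k m (regularSubring s)) :
    evalAt (W.map (regularSubring s).subtype) s = W.map (evalHom s) := rfl

theorem RegularAt.mul [Fintype l] {V : Matrix k l (RatFunc ℂ)} {W : Matrix l m (RatFunc ℂ)}
    (hV : RegularAt V s) (hW : RegularAt W s) : RegularAt (V * W) s := by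
  obtain ⟨V, rfl⟩ := hV.exists_lift
  obtain ⟨W, rfl⟩ := hW.exists_lift
  rw [← Matrix.map_mul]
  exact regularAt_map_subtype _

theorem RegularAt.evalAt_mul [Fintype l] {V : Matrix k l (RatFunc ℂ)}
    {W : Matrix l m (RatFunc ℂ)} (hV : RegularAt V s) (hW : RegularAt W s) :
    evalAt (V * W) s = evalAt V s * evalAt W s := by
  obtain ⟨V, rfl⟩ := hV.exists_lift
  obtain ⟨W, rfl⟩ := hW.exists_lift
  rw [← Matrix.map_mul, evalAt_map_subtype, evalAt_map_subtype, evalAt_map_subtype,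
    Matrix.map_mul]

theorem RegularAt.add {V W : Matrix k m (RatFunc ℂ)}
    (hV : RegularAt V s) (hW : RegularAt W s) : RegularAt (V + W) s :=
  fun i j => (regularSubring s).add_mem (hV i j) (hW i j)

theorem RegularAt.sub {V W : Matrix k m (RatFunc ℂ)}
    (hV : RegularAt V s) (hW : RegularAt W s) : RegularAt (V - W) s :=
  fun i j => (regularSubring s).sub_mem (hV i j) (hW i j)

theorem RegularAt.evalAt_add {V W : Matrix k m (RatFunc ℂ)}
    (hV : RegularAt V s) (hW : RegularAt W s) :
    evalAt (V + W) s = evalAt V s + evalAt W s := by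
  ext i j
  exact map_add (evalHom s) ⟨V i j, hV i j⟩ ⟨W i j, hW i j⟩

theorem regularAt_map_C (M : Matrix k m ℂ) : RegularAt (M.map RatFunc.C) s :=
  fun _ _ => C_mem_regularSubring s _

theorem evalAt_map_C (M : Matrix k m ℂ) : evalAt (M.map RatFunc.C) s = M := by
  ext i j; simp [evalAt]

/-! ### The resolvent over the rational functions -/

variable [Fintype ι] [DecidableEq ι]

/-- The matrix `X I - A` of rational functions. -/
noncomputable def pencil (A : Matrix ι ι ℂ) : Matrix ι ι (RatFunc ℂ) :=
  Matrix.scalar ι RatFunc.X - A.map RatFunc.C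

theorem pencil_eq_map_charmatrix (A : Matrix ι ι ℂ) :
    pencil A = (algebraMap (Polynomial ℂ) (RatFunc ℂ)).mapMatrix (Matrix.charmatrix A) := by
  ext i j
  by_cases h : i = j
  · subst h; simp [pencil, Matrix.charmatrix]
  · simp [pencil, Matrix.charmatrix, h]

theorem det_pencil (A : Matrix ι ι ℂ) :
    (pencil A).det = algebraMap (Polynomial ℂ) (RatFunc ℂ) A.charpoly := by
  rw [pencil_eq_map_charmatrix, ← RingHom.map_det, Matrix.charpoly]

theorem isUnit_det_pencil (A : Matrix ι ι ℂ) : IsUnit (pencil A).det := by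
  rw [det_pencil, isUnit_iff_ne_zero]
  exact RatFunc.algebraMap_ne_zero (Matrix.charpoly_monic A).ne_zero

theorem pencil_mul_inv (A : Matrix ι ι ℂ) : pencil A * (pencil A)⁻¹ = 1 :=
  Matrix.mul_nonsing_inv _ (isUnit_det_pencil A)

theorem inv_mul_pencil (A : Matrix ι ι ℂ) : (pencil A)⁻¹ * pencil A = 1 :=
  Matrix.nonsing_inv_mul _ (isUnit_det_pencil A)

theorem transferFunction_eq (A : Matrix ι ι ℂ) (B : Matrix ι m ℂ) (C : Matrix k ι ℂ)
    (D : Matrix k m ℂ) : transferFunction A B C D =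
      C.map RatFunc.C * (pencil A)⁻¹ * B.map RatFunc.C + D.map RatFunc.C := rfl

theorem scalar_X_mul_map {κ : Type*} [Fintype κ] [DecidableEq κ] (U : Matrix ι κ (RatFunc ℂ)) :
    (Matrix.scalar ι RatFunc.X : Matrix ι ι (RatFunc ℂ)) * U =
      U * (Matrix.scalar κ RatFunc.X : Matrix κ κ (RatFunc ℂ)) := by
  ext i j
  rw [Matrix.scalar_apply, Matrix.scalar_apply, Matrix.diagonal_mul, Matrix.mul_diagonal,
    mul_comm]

/-- Intertwined dynamics matrices have intertwined resolvents. -/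
theorem inv_pencil_mul_of_intertwine {κ : Type*} [Fintype κ] [DecidableEq κ]
    {A : Matrix ι ι ℂ} {a : Matrix κ κ ℂ} {U : Matrix ι κ ℂ} (h : A * U = U * a) :
    (pencil A)⁻¹ * U.map RatFunc.C = U.map RatFunc.C * (pencil a)⁻¹ := by
  have h1 : U.map RatFunc.C * pencil a = pencil A * U.map RatFunc.C := by
    rw [pencil, pencil, Matrix.mul_sub, Matrix.sub_mul, ← scalar_X_mul_map, ← Matrix.map_mul,
      ← Matrix.map_mul, h]
  calc (pencil A)⁻¹ * U.map RatFunc.C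
      = (pencil A)⁻¹ * (U.map RatFunc.C * pencil a) * (pencil a)⁻¹ := by
        rw [Matrix.mul_assoc, Matrix.mul_assoc, pencil_mul_inv, Matrix.mul_one]
    _ = _ := by rw [h1, ← Matrix.mul_assoc, inv_mul_pencil, Matrix.one_mul]

/-- If `A U = U a`, then the states of a realization with dynamics matrix `A` that lie in the
range of `U` can be described by the smaller dynamics matrix `a`. -/
theorem transferFunction_of_intertwine {κ : Type*} [Fintype κ] [DecidableEq κ]
    {A : Matrix ι ι ℂ} {a : Matrix κ κ ℂ} {U : Matrix ι κ ℂ} (h : A * U = U * a)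
    (b : Matrix κ m ℂ) (C : Matrix k ι ℂ) (D : Matrix k m ℂ) :
    transferFunction A (U * b) C D = transferFunction a b (C * U) D := by
  rw [transferFunction_eq, transferFunction_eq, Matrix.map_mul, Matrix.map_mul,
    ← Matrix.mul_assoc, Matrix.mul_assoc (C.map _), inv_pencil_mul_of_intertwine h]
  simp only [Matrix.mul_assoc]

theorem regularAt_pencil (A : Matrix ι ι ℂ) : RegularAt (pencil A) s := by
  rw [pencil_eq_map_charmatrix]
  exact fun i j => algebraMap_mem_regularSubring s _

theorem evalAt_pencil (A : Matrix ι ι ℂ) :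
    evalAt (pencil A) s = Matrix.scalar ι s - A := by
  have : evalAt (pencil A) s = (Matrix.charmatrix A).map (Polynomial.eval s) := by
    rw [pencil_eq_map_charmatrix]
    ext i j
    exact RatFunc.eval_algebraMap (RingHom.id ℂ) s (Matrix.charmatrix A i j)
  rw [this]
  ext i j
  by_cases h : i = j
  · subst h; simp [Matrix.charmatrix]
  · simp [Matrix.charmatrix, h]

omit [Fintype ι] in
theorem evalAt_one : evalAt (1 : Matrix ι ι (RatFunc ℂ)) s = 1 := by
  ext i j
  by_cases hij : i = j
  · subst hij; simp [evalAt]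
  · simp [evalAt, hij]

theorem regularAt_inv_pencil {A : Matrix ι ι ℂ} (h : A.charpoly.eval s ≠ 0) :
    RegularAt (pencil A)⁻¹ s := by
  intro i j
  have : (pencil A)⁻¹ i j = algebraMap _ (RatFunc ℂ) ((Matrix.charmatrix A).adjugate i j) /
      algebraMap _ (RatFunc ℂ) A.charpoly := by
    rw [Matrix.inv_def, det_pencil, Ring.inverse_eq_inv', pencil_eq_map_charmatrix,
      ← RingHom.map_adjugate, div_eq_inv_mul]
    rfl
  rw [this]
  exact div_mem_regularSubring _ _ h

theorem scalar_sub_mul_evalAt_inv_pencil {A : Matrix ι ι ℂ} (h : A.charpoly.eval s ≠ 0) :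
    (Matrix.scalar ι s - A) * evalAt (pencil A)⁻¹ s = 1 := by
  rw [← evalAt_pencil, ← (regularAt_pencil A).evalAt_mul (regularAt_inv_pencil h),
    pencil_mul_inv, evalAt_one]

theorem regularAt_transferFunction {A : Matrix ι ι ℂ} (h : A.charpoly.eval s ≠ 0)
    (B : Matrix ι m ℂ) (C : Matrix k ι ℂ) (D : Matrix k m ℂ) :
    RegularAt (transferFunction A B C D) s :=
  (((regularAt_map_C C).mul (regularAt_inv_pencil h)).mul (regularAt_map_C B)).add
    (regularAt_map_C D)

theorem evalAt_transferFunction {A : Matrix ι ι ℂ} (h : A.charpoly.eval s ≠ 0)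
    (B : Matrix ι m ℂ) (C : Matrix k ι ℂ) (D : Matrix k m ℂ) :
    evalAt (transferFunction A B C D) s = C * evalAt (pencil A)⁻¹ s * B + D := by
  have h1 := (regularAt_map_C C).mul (regularAt_inv_pencil h)
  rw [transferFunction_eq, (h1.mul (regularAt_map_C B)).evalAt_add (regularAt_map_C D),
    h1.evalAt_mul (regularAt_map_C B),
    (regularAt_map_C C).evalAt_mul (regularAt_inv_pencil h), evalAt_map_C, evalAt_map_C,
    evalAt_map_C]

theorem charpoly_eval_eq_zero_iff (A : Matrix ι ι ℂ) :
    A.charpoly.eval s = 0 ↔ ∃ v, v ≠ 0 ∧ A *ᵥ v = s • v := by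
  rw [Matrix.eval_charpoly, ← Matrix.exists_mulVec_eq_zero_iff]
  simp only [Matrix.sub_mulVec, sub_eq_zero]
  refine exists_congr fun v => and_congr_right fun _ => ?_
  rw [eq_comm]
  simp [Matrix.scalar_apply, ← Matrix.smul_one_eq_diagonal, Matrix.smul_mulVec]

end Matrices

/-! ### Observability and controllability -/

section Hautus

variable {k m ι κ : Type*} [Fintype ι] [Fintype κ]

/-- Observability of the pair `(C, A)`, in the form of the Hautus test: no eigenvector of `A`
lies in the kernel of `C`. -/
def IsObservable (C : Matrix k ι ℂ) (A : Matrix ι ι ℂ) : Prop :=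
  ∀ (z : ℂ) (v : ι → ℂ), A *ᵥ v = z • v → C *ᵥ v = 0 → v = 0

/-- Controllability of the pair `(A, B)`, in the form of the Hautus test: no left eigenvector
of `A` lies in the left kernel of `B`. -/
def IsControllable (A : Matrix ι ι ℂ) (B : Matrix ι m ℂ) : Prop :=
  ∀ (z : ℂ) (v : ι → ℂ), v ᵥ* A = z • v → v ᵥ* B = 0 → v = 0

variable [DecidableEq ι] [DecidableEq κ]

/-- The unobservable states form an invariant subspace, which would contain an eigenvector. -/
theorem IsObservable.eq_zero_of_forall_pow {C : Matrix k ι ℂ} {A : Matrix ι ι ℂ}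
    (h : IsObservable C A) {v : ι → ℂ} (hv : ∀ i : ℕ, (C * A ^ i) *ᵥ v = 0) : v = 0 := by
  let N : Submodule ℂ (ι → ℂ) := ⨅ i : ℕ, LinearMap.ker (C * A ^ i).mulVecLin
  have hN : ∀ x, x ∈ N ↔ ∀ i : ℕ, (C * A ^ i) *ᵥ x = 0 := by simp [N]
  have hinv : ∀ x ∈ N, A.mulVecLin x ∈ N := by
    intro x hx
    rw [hN] at hx ⊢
    intro i
    have := hx (i + 1)
    rwa [pow_succ, ← Matrix.mul_assoc, ← Matrix.mulVec_mulVec] at this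
  by_contra hv0
  have : Nontrivial N := ⟨⟨v, (hN v).2 hv⟩, 0, fun e => hv0 (congrArg Subtype.val e)⟩
  obtain ⟨z, hz⟩ := Module.End.exists_eigenvalue (A.mulVecLin.restrict hinv)
  obtain ⟨x, hx⟩ := hz.exists_hasEigenvector
  refine hx.2 (Subtype.ext (h z x ?_ ?_))
  · exact congrArg Subtype.val hx.apply_eq_smul
  · simpa using (hN x).1 x.2 0

omit [DecidableEq ι] in
theorem IsControllable.isObservable_transpose {A : Matrix ι ι ℂ} {B : Matrix ι m ℂ}
    (h : IsControllable A B) : IsObservable Bᵀ Aᵀ := fun z w h1 h2 =>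
  h z w (by rwa [Matrix.mulVec_transpose] at h1) (by rwa [Matrix.mulVec_transpose] at h2)

theorem IsControllable.eq_zero_of_forall_pow {A : Matrix ι ι ℂ} {B : Matrix ι m ℂ}
    (h : IsControllable A B) {v : ι → ℂ} (hv : ∀ i : ℕ, v ᵥ* (A ^ i * B) = 0) : v = 0 := by
  refine h.isObservable_transpose.eq_zero_of_forall_pow fun i => ?_
  rw [← Matrix.transpose_pow, ← Matrix.transpose_mul, Matrix.mulVec_transpose, hv]

omit [DecidableEq κ] in
theorem submodule_eq_top_of_dotProduct (N : Submodule ℂ (κ → ℂ))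
    (h : ∀ x, (∀ y ∈ N, y ⬝ᵥ x = 0) → x = 0) : N = ⊤ := by
  classical
  by_contra hN
  obtain ⟨f, hf, hle⟩ := Submodule.exists_le_ker_of_lt_top N (lt_top_iff_ne_top.2 hN)
  have hfx : ∀ y, f y = y ⬝ᵥ fun i => f (Pi.single i 1) := by
    intro y
    rw [LinearMap.pi_apply_eq_sum_univ f y]
    simp only [dotProduct, smul_eq_mul]
    refine Finset.sum_congr rfl fun i _ => ?_
    congr 2
    ext j
    simp [Pi.single_apply, eq_comm]
  have h0 : (fun i => f (Pi.single i 1)) = 0 := h _ fun y hy => by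
    rw [← hfx y]
    exact hle hy
  refine hf (LinearMap.ext fun y => ?_)
  rw [hfx y, h0]
  simp

/-- The rows of the observability matrix span the state space. -/
theorem IsObservable.eq_top {C : Matrix k ι ℂ} {A : Matrix ι ι ℂ} (h : IsObservable C A)
    (N : Submodule ℂ (ι → ℂ)) (hN : ∀ (i : ℕ) (j : k), (C * A ^ i) j ∈ N) : N = ⊤ :=
  submodule_eq_top_of_dotProduct N fun _ hx =>
    h.eq_zero_of_forall_pow fun i => funext fun j => hx _ (hN i j)

/-- The columns of the controllability matrix span the state space. -/
theorem IsControllable.eq_top {A : Matrix ι ι ℂ} {B : Matrix ι m ℂ} (h : IsControllable A B)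
    (N : Submodule ℂ (ι → ℂ)) (hN : ∀ (i : ℕ) (j : m), (A ^ i * B).col j ∈ N) : N = ⊤ :=
  submodule_eq_top_of_dotProduct N fun x hx =>
    h.eq_zero_of_forall_pow fun i => funext fun j => by
      rw [Matrix.vecMul, dotProduct_comm]
      exact hx _ (hN i j)

/-! ### Markov parameters and the McMillan degree -/

open scoped Classical in
theorem inftyValuation_C_le_one (z : ℂ) :
    RatFunc.inftyValuation ℂ (RatFunc.C z) ≤ 1 := by
  by_cases hz : z = 0
  · simp [hz]
  · exact (RatFunc.inftyValuation.C ℂ hz).le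

open scoped Classical in
/-- The resolvent is strictly proper: from `X R = 1 + A R`, an entry of largest order at
infinity would otherwise have an even larger order. -/
theorem inftyValuation_inv_pencil_lt_one (A : Matrix ι ι ℂ) (i j : ι) :
    RatFunc.inftyValuation ℂ ((pencil A)⁻¹ i j) < 1 := by
  set v := RatFunc.inftyValuation ℂ with hv
  set R := (pencil A)⁻¹ with hR
  by_contra! hij
  have : Nonempty (ι × ι) := ⟨(i, j)⟩
  obtain ⟨⟨i₀, j₀⟩, hmax⟩ := Finite.exists_max fun q : ι × ι => v (R q.1 q.2)
  have hM : 1 ≤ v (R i₀ j₀) := hij.trans (hmax (i, j))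
  have hRX : (Matrix.scalar ι RatFunc.X : Matrix ι ι (RatFunc ℂ)) * R
      = 1 + A.map RatFunc.C * R := by
    rw [← pencil_mul_inv A, pencil, Matrix.sub_mul]
    simp [hR, pencil]
  have hX := congrFun (congrFun hRX i₀) j₀
  rw [Matrix.scalar_apply, Matrix.diagonal_mul, Matrix.add_apply] at hX
  have h1 : v ((1 : Matrix ι ι (RatFunc ℂ)) i₀ j₀) ≤ v (R i₀ j₀) := by
    refine le_trans ?_ hM
    rw [Matrix.one_apply]
    split_ifs <;> simp
  have h2 : v ((A.map RatFunc.C * R) i₀ j₀) ≤ v (R i₀ j₀) := by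
    rw [Matrix.mul_apply]
    refine Valuation.map_sum_le _ fun l _ => ?_
    rw [map_mul]
    calc _ ≤ 1 * v (R i₀ j₀) := mul_le_mul' (inftyValuation_C_le_one _) (hmax (l, j₀))
      _ = _ := one_mul _
  have h3 : v RatFunc.X * v (R i₀ j₀) ≤ v (R i₀ j₀) := by
    rw [← map_mul, hX]
    exact v.map_add_le h1 h2
  have h4 : v (RatFunc.X : RatFunc ℂ) ≤ 1 := by
    have hpos : 0 < v (R i₀ j₀) := lt_of_lt_of_le zero_lt_one hM
    exact le_of_mul_le_mul_right (by rwa [one_mul]) hpos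
  rw [hv, RatFunc.inftyValuation.X, ← WithZero.exp_zero, WithZero.exp_le_exp] at h4
  omega

open scoped Classical in
theorem inftyValuation_transferFunction_zero_lt_one (A : Matrix ι ι ℂ) (B : Matrix ι m ℂ)
    (C : Matrix k ι ℂ) (i : k) (j : m) :
    RatFunc.inftyValuation ℂ (transferFunction A B C 0 i j) < 1 := by
  rw [transferFunction_eq, Matrix.map_zero _ (map_zero RatFunc.C), add_zero, Matrix.mul_apply]
  refine Valuation.map_sum_lt _ one_ne_zero fun l _ => ?_
  rw [map_mul, Matrix.mul_apply]
  refine (mul_le_mul' le_rfl (inftyValuation_C_le_one _)).trans_lt ?_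
  rw [mul_one]
  refine Valuation.map_sum_lt _ one_ne_zero fun l' _ => ?_
  rw [map_mul]
  refine (mul_le_mul' (inftyValuation_C_le_one _) le_rfl).trans_lt ?_
  rw [one_mul]
  exact inftyValuation_inv_pencil_lt_one _ _ _

theorem transferFunction_eq_add (A : Matrix ι ι ℂ) (B : Matrix ι m ℂ) (C : Matrix k ι ℂ)
    (D : Matrix k m ℂ) :
    transferFunction A B C D = transferFunction A B C 0 + D.map RatFunc.C := by
  rw [transferFunction_eq, transferFunction_eq]
  ext
  simp

/-- The value at infinity and the strictly proper part of a transfer function are unique. -/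
theorem transferFunction_feedthrough_unique {A : Matrix ι ι ℂ} {B : Matrix ι m ℂ}
    {C : Matrix k ι ℂ} {D : Matrix k m ℂ} {A' : Matrix κ κ ℂ} {B' : Matrix κ m ℂ}
    {C' : Matrix k κ ℂ} {D' : Matrix k m ℂ}
    (h : transferFunction A B C D = transferFunction A' B' C' D') :
    D = D' ∧ transferFunction A B C 0 = transferFunction A' B' C' 0 := by
  classical
  have hD : D = D' := by
    ext i j
    by_contra hne
    have h1 := RatFunc.inftyValuation.C ℂ (sub_ne_zero.2 hne)
    have h2 := congrFun (congrFun h i) j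
    rw [transferFunction_eq_add A, transferFunction_eq_add A', Matrix.add_apply,
      Matrix.add_apply, Matrix.map_apply, Matrix.map_apply] at h2
    have h3 : (RatFunc.C (D i j - D' i j) : RatFunc ℂ) =
        transferFunction A' B' C' 0 i j - transferFunction A B C 0 i j := by
      rw [map_sub]; linear_combination h2
    rw [h3] at h1
    exact (Valuation.map_sub_lt _ (inftyValuation_transferFunction_zero_lt_one A' B' C' i j)
      (inftyValuation_transferFunction_zero_lt_one A B C i j)).ne h1
  refine ⟨hD, ?_⟩
  subst hD
  rw [transferFunction_eq_add A, transferFunction_eq_add A'] at h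
  exact add_right_cancel h

/-- Multiplication by `X` shifts the Markov parameters. -/
theorem X_smul_transferFunction (A : Matrix ι ι ℂ) (B : Matrix ι m ℂ) (C : Matrix k ι ℂ) :
    (RatFunc.X : RatFunc ℂ) • transferFunction A B C 0 =
      transferFunction A B (C * A) (C * B) := by
  have hRX : (RatFunc.X : RatFunc ℂ) • (pencil A)⁻¹ = 1 + A.map RatFunc.C * (pencil A)⁻¹ := by
    rw [← pencil_mul_inv A]
    nth_rw 2 [pencil]
    rw [Matrix.sub_mul, sub_add_cancel]
    ext i j
    rw [Matrix.scalar_apply, Matrix.diagonal_mul, Matrix.smul_apply, smul_eq_mul]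
  rw [transferFunction_eq, transferFunction_eq, Matrix.map_zero _ (map_zero RatFunc.C),
    add_zero, ← Matrix.smul_mul, ← Matrix.mul_smul, hRX, Matrix.map_mul, Matrix.map_mul]
  simp only [Matrix.mul_add, Matrix.add_mul, Matrix.mul_one, Matrix.mul_assoc]
  exact add_comm _ _

/-- The Markov parameters are the coefficients of the expansion at infinity. -/
theorem markov_parameters_unique {A : Matrix ι ι ℂ} {B : Matrix ι m ℂ}
    {C : Matrix k ι ℂ} {D : Matrix k m ℂ} {A' : Matrix κ κ ℂ} {B' : Matrix κ m ℂ}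
    {C' : Matrix k κ ℂ} {D' : Matrix k m ℂ}
    (h : transferFunction A B C D = transferFunction A' B' C' D') (i : ℕ) :
    C * A ^ i * B = C' * A' ^ i * B' := by
  induction i generalizing C C' D D' with
  | zero =>
    have h1 := (transferFunction_feedthrough_unique h).2
    have h2 : transferFunction A B (C * A) (C * B) =
        transferFunction A' B' (C' * A') (C' * B') := by
      rw [← X_smul_transferFunction, h1, X_smul_transferFunction]
    simpa using (transferFunction_feedthrough_unique h2).1
  | succ i ih =>
    have h1 := (transferFunction_feedthrough_unique h).2
    have h2 : transferFunction A B (C * A) (C * B) =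
        transferFunction A' B' (C' * A') (C' * B') := by
      rw [← X_smul_transferFunction, h1, X_smul_transferFunction]
    simpa only [pow_succ', Matrix.mul_assoc] using ih h2

theorem mulVec_col_mul_pow (C : Matrix k ι ℂ) (A : Matrix ι ι ℂ) (B : Matrix ι m ℂ) (i j : ℕ)
    (l : m) : (C * A ^ i) *ᵥ (A ^ j * B).col l = (C * A ^ (i + j) * B).col l := by
  rw [pow_add]
  simp only [← Matrix.mul_assoc]
  rw [Matrix.mul_assoc (C * A ^ i) (A ^ j) B]
  rfl

/-- The Hankel map (controllability map followed by observability map) depends on the transfer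
function only. Its rank is the size of an observable and controllable realization, and at most
the size of any other realization. -/
theorem card_le_of_transferFunction_eq {A : Matrix ι ι ℂ} {B : Matrix ι m ℂ}
    {C : Matrix k ι ℂ} {D : Matrix k m ℂ} {A' : Matrix κ κ ℂ} {B' : Matrix κ m ℂ}
    {C' : Matrix k κ ℂ} {D' : Matrix k m ℂ} (hC : IsObservable C A) (hB : IsControllable A B)
    (h : transferFunction A B C D = transferFunction A' B' C' D') :
    Fintype.card ι ≤ Fintype.card κ := by
  let O : (ι → ℂ) →ₗ[ℂ] (ℕ → k → ℂ) := LinearMap.pi fun i => (C * A ^ i).mulVecLin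
  let O' : (κ → ℂ) →ₗ[ℂ] (ℕ → k → ℂ) := LinearMap.pi fun i => (C' * A' ^ i).mulVecLin
  let R : (ℕ × m →₀ ℂ) →ₗ[ℂ] (ι → ℂ) :=
    Finsupp.linearCombination ℂ fun q => (A ^ q.1 * B).col q.2
  let R' : (ℕ × m →₀ ℂ) →ₗ[ℂ] (κ → ℂ) :=
    Finsupp.linearCombination ℂ fun q => (A' ^ q.1 * B').col q.2
  have hcomp : O ∘ₗ R = O' ∘ₗ R' := by
    refine Finsupp.lhom_ext fun q z => ?_
    funext i
    simp only [O, R, O', R', LinearMap.comp_apply, Finsupp.linearCombination_single,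
      map_smul, LinearMap.pi_apply, Matrix.mulVecLin_apply]
    rw [mulVec_col_mul_pow, mulVec_col_mul_pow, markov_parameters_unique h]
  have hO : Function.Injective O := by
    rw [injective_iff_map_eq_zero]
    intro x hx
    exact hC.eq_zero_of_forall_pow fun i => congrFun hx i
  have hR : LinearMap.range R = ⊤ :=
    hB.eq_top _ fun i j => ⟨Finsupp.single (i, j) 1, by simp [R]⟩
  have h1 : LinearMap.range (O ∘ₗ R) = LinearMap.range O := by
    rw [LinearMap.range_comp, hR, LinearMap.range_eq_map]
  have h2 : LinearMap.range O ≤ LinearMap.range O' := by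
    rw [← h1, hcomp]
    exact LinearMap.range_comp_le_range _ _
  calc Fintype.card ι = Module.finrank ℂ (ι → ℂ) := (Module.finrank_fintype_fun_eq_card ℂ).symm
    _ = Module.finrank ℂ (LinearMap.range O) := (LinearMap.finrank_range_of_inj hO).symm
    _ ≤ Module.finrank ℂ (LinearMap.range O') := Submodule.finrank_mono h2
    _ ≤ Module.finrank ℂ (κ → ℂ) := LinearMap.finrank_range_le O'
    _ = Fintype.card κ := Module.finrank_fintype_fun_eq_card ℂ

theorem hasMcMillanDegree_of_isObservable_isControllable {r : ℕ} {A : Matrix (Fin r) (Fin r) ℂ}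
    {B : Matrix (Fin r) m ℂ} {C : Matrix k (Fin r) ℂ} {D : Matrix k m ℂ}
    (hC : IsObservable C A) (hB : IsControllable A B) :
    HasMcMillanDegree (transferFunction A B C D) r := by
  refine ⟨⟨A, B, C, D, rfl⟩, ?_⟩
  rintro n ⟨A', B', C', D', h⟩
  simpa using card_le_of_transferFunction_eq hC hB h

/-- An eigenvector of `A` in the kernel of `C` can be divided out of the state space, which
gives a smaller realization. -/
theorem IsMinimalRealization.isObservable {n : ℕ} {A : Matrix (Fin n) (Fin n) ℂ}
    {B : Matrix (Fin n) m ℂ} {C : Matrix k (Fin n) ℂ} {D : Matrix k m ℂ}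
    {W : Matrix k m (RatFunc ℂ)} (h : IsMinimalRealization A B C D W) : IsObservable C A := by
  intro z v hAv hCv
  by_contra hv
  let N : Submodule ℂ (Fin n → ℂ) := ℂ ∙ v
  let e := (Module.finBasis ℂ ((Fin n → ℂ) ⧸ N)).equivFun
  let l : (Fin n → ℂ) →ₗ[ℂ] (Fin (Module.finrank ℂ ((Fin n → ℂ) ⧸ N)) → ℂ) :=
    e.toLinearMap ∘ₗ N.mkQ
  have hlsurj : LinearMap.range l = ⊤ := by
    rw [LinearMap.range_eq_top]
    exact e.surjective.comp N.mkQ_surjective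
  obtain ⟨j, hj⟩ := LinearMap.exists_rightInverse_of_surjective l hlsurj
  have hker : ∀ x, l x = 0 → ∃ t : ℂ, t • v = x := by
    intro x hx
    have : N.mkQ x = 0 := e.injective (by simpa [l] using hx)
    rw [Submodule.mkQ_apply, Submodule.Quotient.mk_eq_zero] at this
    exact Submodule.mem_span_singleton.1 this
  have hlv : l v = 0 := by
    have : N.mkQ v = 0 := by
      rw [Submodule.mkQ_apply, Submodule.Quotient.mk_eq_zero]
      exact Submodule.mem_span_singleton_self v
    simp only [l, LinearMap.comp_apply, this, map_zero]
  have hjl : ∀ x, ∃ t : ℂ, x = j (l x) + t • v := by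
    intro x
    obtain ⟨t, ht⟩ := hker (x - j (l x)) (by
      rw [map_sub, sub_eq_zero]
      exact (LinearMap.congr_fun hj (l x)).symm)
    exact ⟨t, by rw [ht]; abel⟩
  let L := LinearMap.toMatrix' l
  let J := LinearMap.toMatrix' j
  have hL : ∀ x, L *ᵥ x = l x := fun x => LinearMap.toMatrix'_mulVec l x
  have hJ : ∀ x, J *ᵥ x = j x := fun x => LinearMap.toMatrix'_mulVec j x
  have hCJ : C * J * L = C := by
    refine Matrix.ext_of_mulVec_single fun i => ?_
    generalize (Pi.single i 1 : Fin n → ℂ) = x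
    obtain ⟨t, ht⟩ := hjl x
    nth_rw 2 [ht]
    rw [Matrix.mulVec_add, Matrix.mulVec_smul, hCv, smul_zero, add_zero,
      ← Matrix.mulVec_mulVec, ← Matrix.mulVec_mulVec, hL, hJ]
  have hAJ : L * A * J * L = L * A := by
    refine Matrix.ext_of_mulVec_single fun i => ?_
    generalize (Pi.single i 1 : Fin n → ℂ) = x
    obtain ⟨t, ht⟩ := hjl x
    have : (L * A) *ᵥ v = 0 := by
      rw [← Matrix.mulVec_mulVec, hAv, Matrix.mulVec_smul, hL, hlv, smul_zero]
    nth_rw 2 [ht]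
    rw [Matrix.mulVec_add, Matrix.mulVec_smul, this, smul_zero, add_zero,
      ← Matrix.mulVec_mulVec, ← Matrix.mulVec_mulVec, hL, hJ]
  have hle := h.2.2 ⟨L * A * J, L * B, C * J, D, by
    rw [h.1, transferFunction_of_intertwine hAJ, hCJ]⟩
  have hN : Module.finrank ℂ N = 1 := finrank_span_singleton hv
  have hsum := Submodule.finrank_quotient_add_finrank N
  rw [Module.finrank_fintype_fun_eq_card, Fintype.card_fin] at hsum
  omega

/-! ### Poles of a minimal realization -/

theorem transferFunction_transpose (A : Matrix ι ι ℂ) (B : Matrix ι m ℂ) (C : Matrix k ι ℂ)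
    (D : Matrix k m ℂ) : (transferFunction A B C D)ᵀ = transferFunction Aᵀ Cᵀ Bᵀ Dᵀ := by
  have h : (pencil A)ᵀ = pencil Aᵀ := by
    rw [pencil, pencil, Matrix.transpose_sub, Matrix.scalar_apply, Matrix.diagonal_transpose,
      Matrix.transpose_map]
  rw [transferFunction_eq, transferFunction_eq, Matrix.transpose_add, Matrix.transpose_mul,
    Matrix.transpose_mul, Matrix.transpose_nonsing_inv, h, Matrix.transpose_map,
    Matrix.transpose_map, Matrix.transpose_map, Matrix.mul_assoc]

theorem regularAt_transferFunction_zero {A : Matrix ι ι ℂ} {B : Matrix ι m ℂ}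
    {C : Matrix k ι ℂ} {D : Matrix k m ℂ} {s : ℂ} (h : RegularAt (transferFunction A B C D) s) :
    RegularAt (transferFunction A B C 0) s := by
  rw [eq_sub_of_add_eq (transferFunction_eq_add A B C D).symm]
  exact h.sub (regularAt_map_C D)

theorem regularAt_transferFunction_mul_pow {A : Matrix ι ι ℂ} {B : Matrix ι m ℂ}
    {C : Matrix k ι ℂ} {D : Matrix k m ℂ} {s : ℂ} (h : RegularAt (transferFunction A B C D) s)
    (i : ℕ) : RegularAt (transferFunction A B (C * A ^ i) 0) s := by
  induction i with
  | zero => simpa using regularAt_transferFunction_zero h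
  | succ i ih =>
    rw [pow_succ, ← Matrix.mul_assoc]
    refine regularAt_transferFunction_zero (D := C * A ^ i * B) ?_
    rw [← X_smul_transferFunction]
    exact fun a b => (regularSubring s).mul_mem (X_mem_regularSubring s) (ih a b)

/-- If `C R B` has no pole at `s`, then the coefficient rows `y` such that `y R B` has no pole at
`s` include all rows of `C Aⁱ`, which span the space. -/
theorem IsObservable.regularAt_transferFunction_one {A : Matrix ι ι ℂ} {B : Matrix ι m ℂ}
    {C : Matrix k ι ℂ} {D : Matrix k m ℂ} (hC : IsObservable C A)
    {s : ℂ} (h : RegularAt (transferFunction A B C D) s) :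
    RegularAt (transferFunction A B (1 : Matrix ι ι ℂ) 0) s := by
  let N : Submodule ℂ (ι → ℂ) :=
    { carrier := {y | ∀ j, ∑ l, RatFunc.C (y l) * transferFunction A B (1 : Matrix ι ι ℂ) 0 l j ∈
        regularSubring s}
      add_mem' := fun {x y} hx hy j => by
        simpa [add_mul, Finset.sum_add_distrib] using (regularSubring s).add_mem (hx j) (hy j)
      zero_mem' := fun j => by simp
      smul_mem' := fun z x hx j => by
        simpa [mul_assoc, Finset.mul_sum] using
          (regularSubring s).mul_mem (C_mem_regularSubring s z) (hx j) }
  have hN : N = ⊤ := by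
    refine hC.eq_top N fun i x j => ?_
    have h1 : (1 : Matrix ι ι ℂ).map (RatFunc.C : ℂ →+* RatFunc ℂ) = 1 := by
      simp
    have := regularAt_transferFunction_mul_pow h i x j
    rw [transferFunction_eq, Matrix.map_zero _ (map_zero RatFunc.C), add_zero,
      Matrix.mul_assoc, Matrix.mul_apply] at this
    rw [transferFunction_eq, Matrix.map_zero _ (map_zero RatFunc.C), add_zero, h1, Matrix.one_mul]
    exact this
  intro i j
  have hi : (Pi.single i 1 : ι → ℂ) ∈ N := hN ▸ Submodule.mem_top
  have := hi j
  rw [Finset.sum_eq_single i (fun l _ hl => by simp [hl]) (by simp),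
    Pi.single_eq_same, map_one, one_mul] at this
  exact this

/-- An observable and controllable realization has a pole at every eigenvalue of its dynamics
matrix: if `C R B` is regular at `s`, where `R` is the resolvent, then so are all `C Aⁱ R Aʲ B`,
hence `R` itself, and `det R` is the inverse of the characteristic polynomial. -/
theorem charpoly_eval_ne_zero_of_regularAt {A : Matrix ι ι ℂ} {B : Matrix ι m ℂ}
    {C : Matrix k ι ℂ} {D : Matrix k m ℂ} (hC : IsObservable C A) (hB : IsControllable A B)
    {s : ℂ} (h : RegularAt (transferFunction A B C D) s) : A.charpoly.eval s ≠ 0 := by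
  have h1 := hC.regularAt_transferFunction_one h
  have h2 : RegularAt (transferFunction Aᵀ (1 : Matrix ι ι ℂ) Bᵀ 0) s := by
    have := transferFunction_transpose A B (1 : Matrix ι ι ℂ) 0
    rw [Matrix.transpose_one, Matrix.transpose_zero] at this
    rw [← this]
    exact fun i j => h1 j i
  have h3 := hB.isObservable_transpose.regularAt_transferFunction_one h2
  have h4 : transferFunction Aᵀ (1 : Matrix ι ι ℂ) 1 0 = (pencil Aᵀ)⁻¹ := by
    rw [transferFunction_eq]
    ext
    simp
  rw [h4] at h3
  intro h0
  have h5 : evalAt (pencil Aᵀ) s * evalAt (pencil Aᵀ)⁻¹ s = 1 := by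
    rw [← (regularAt_pencil _).evalAt_mul h3, pencil_mul_inv, evalAt_one]
  have h6 := congrArg Matrix.det h5
  rw [Matrix.det_mul, Matrix.det_one, evalAt_pencil, ← Matrix.eval_charpoly,
    Matrix.charpoly_transpose, h0, zero_mul] at h6
  exact zero_ne_one h6

end Hautus

open scoped ComplexOrder

/-! ### Lyapunov's theorem -/

section Lyapunov

variable {ι : Type*} [Fintype ι] [DecidableEq ι]

open scoped Matrix.Norms.L2Operator in
open Filter Topology in
/-- By Gelfand's formula, `‖fᵏ‖ < rᵏ` for large `k` if `r` exceeds the spectral radius. -/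
theorem tendsto_pow_zero_of_eigenvalues_lt_one {f : Matrix ι ι ℂ}
    (hf : ∀ (z : ℂ) (v : ι → ℂ), v ≠ 0 → f *ᵥ v = z • v → ‖z‖ < 1) :
    Tendsto (fun k : ℕ => f ^ k) atTop (𝓝 0) := by
  cases isEmpty_or_nonempty ι with
  | inl h => simp [Subsingleton.elim (_ : Matrix ι ι ℂ) 0]
  | inr h =>
    have hrad : spectralRadius ℂ f < ((1 : NNReal) : ENNReal) := by
      refine spectrum.spectralRadius_lt_of_forall_lt f fun z hz => ?_
      rw [Matrix.mem_spectrum_iff_isRoot_charpoly, Polynomial.IsRoot,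
        charpoly_eval_eq_zero_iff] at hz
      obtain ⟨v, hv, hfv⟩ := hz
      exact hf z v hv hfv
    obtain ⟨r, hr, hr1⟩ := ENNReal.lt_iff_exists_nnreal_btwn.1 hrad
    rw [ENNReal.coe_lt_coe] at hr1
    have hgel :=
      (spectrum.pow_nnnorm_pow_one_div_tendsto_nhds_spectralRadius f).eventually_lt_const hr
    rw [tendsto_zero_iff_norm_tendsto_zero]
    refine squeeze_zero' (Eventually.of_forall fun _ => norm_nonneg _) ?_
      (tendsto_pow_atTop_nhds_zero_of_lt_one r.2 hr1)
    filter_upwards [hgel, eventually_gt_atTop 0] with k hk hk0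
    have hk' : (0 : ℝ) < k := by exact_mod_cast hk0
    have h1 := ENNReal.rpow_le_rpow hk.le hk'.le
    rw [← ENNReal.rpow_mul, one_div_mul_cancel hk'.ne', ENNReal.rpow_one,
      ENNReal.rpow_natCast] at h1
    exact_mod_cast h1

open Filter Topology in
/-- Lyapunov's theorem. The Cayley transform `f = (1 + a) (1 - a)⁻¹` of `a` has its eigenvalues
in the open unit disc and satisfies `f Y f* ≤ Y`; iterating, `Y ≥ fᵏ Y (fᵏ)* → 0`. -/
theorem posSemidef_of_lyapunov {a Y : Matrix ι ι ℂ} (hY : Y.IsHermitian)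
    (ha : ∀ (z : ℂ) (v : ι → ℂ), v ≠ 0 → a *ᵥ v = z • v → z.re < 0)
    (h : (-(a * Y + Y * aᴴ)).PosSemidef) : Y.PosSemidef := by
  have hu : IsUnit (1 - a).det := by
    rw [isUnit_iff_ne_zero]
    intro h0
    obtain ⟨v, hv, hav⟩ := Matrix.exists_mulVec_eq_zero_iff.2 h0
    rw [Matrix.sub_mulVec, Matrix.one_mulVec, sub_eq_zero] at hav
    have := ha 1 v hv (by rw [one_smul, ← hav])
    norm_num at this
  set g := (1 - a)⁻¹ with hg
  have hg1 : (1 - a) * g = 1 := Matrix.mul_nonsing_inv _ hu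
  have hg2 : g * (1 - a) = 1 := Matrix.nonsing_inv_mul _ hu
  set f := g * (1 + a) with hf
  have hpow : Tendsto (fun k : ℕ => f ^ k) atTop (𝓝 0) := by
    refine tendsto_pow_zero_of_eigenvalues_lt_one fun z v hv hfv => ?_
    have h1 : v + a *ᵥ v = z • (v - a *ᵥ v) := by
      have : (1 - a) *ᵥ (f *ᵥ v) = (1 + a) *ᵥ v := by
        rw [Matrix.mulVec_mulVec, hf, ← Matrix.mul_assoc, hg1, Matrix.one_mul]
      rw [hfv, Matrix.mulVec_smul, Matrix.sub_mulVec, Matrix.add_mulVec, Matrix.one_mulVec] at this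
      exact this.symm
    have h2 : (z + 1) • a *ᵥ v = (z - 1) • v := by
      rw [add_smul, sub_smul, one_smul, one_smul, eq_sub_iff_add_eq, add_assoc, add_comm _ v, h1,
        smul_sub]
      abel
    have hz : z + 1 ≠ 0 := by
      intro hz
      rw [hz, zero_smul, eq_comm, smul_eq_zero] at h2
      rcases h2 with h2 | h2
      · rw [eq_neg_of_add_eq_zero_left hz] at h2
        norm_num at h2
      · exact hv h2
    have h3 := ha ((z - 1) / (z + 1)) v hv (by
      rw [div_eq_inv_mul, mul_smul, ← h2, smul_smul, inv_mul_cancel₀ hz, one_smul])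
    have hn : 0 < Complex.normSq (z + 1) := Complex.normSq_pos.2 hz
    rw [Complex.div_re, ← add_div, div_lt_iff₀ hn, zero_mul] at h3
    simp at h3
    rw [← sq_lt_one_iff₀ (norm_nonneg z), Complex.sq_norm, Complex.normSq_apply]
    nlinarith
  have hstep : (Y - f * Y * fᴴ).PosSemidef := by
    have h1 : Y - f * Y * fᴴ = g * (-(a * Y + Y * aᴴ) + -(a * Y + Y * aᴴ)) * gᴴ := by
      have hgH : (1 - aᴴ) * gᴴ = 1 := by
        rw [← Matrix.conjTranspose_one, ← Matrix.conjTranspose_sub, ← Matrix.conjTranspose_mul,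
          hg2, Matrix.conjTranspose_one]
      have hYg : Y = g * ((1 - a) * Y * (1 - aᴴ)) * gᴴ := by
        calc Y = (g * (1 - a)) * Y * ((1 - aᴴ) * gᴴ) := by rw [hg2, hgH]; simp
          _ = _ := by noncomm_ring
      have hfH : fᴴ = (1 + aᴴ) * gᴴ := by
        rw [hf, Matrix.conjTranspose_mul, Matrix.conjTranspose_add, Matrix.conjTranspose_one]
      nth_rw 1 [hYg]
      rw [hfH, hf]
      noncomm_ring
    rw [h1]
    exact (h.add h).mul_mul_conjTranspose_same g
  have hiter : ∀ k : ℕ, (Y - f ^ k * Y * (f ^ k)ᴴ).PosSemidef := by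
    intro k
    induction k with
    | zero => simpa using Matrix.PosSemidef.zero
    | succ k ih =>
      have := ih.add (hstep.mul_mul_conjTranspose_same (f ^ k))
      convert this using 1
      rw [pow_succ, Matrix.conjTranspose_mul]
      noncomm_ring
  have hlim : Tendsto (fun k : ℕ => Y - f ^ k * Y * (f ^ k)ᴴ) atTop (𝓝 Y) := by
    have hc : Continuous fun q : Matrix ι ι ℂ => Y - q * Y * qᴴ := by fun_prop
    have := (hc.tendsto 0).comp hpow
    simpa [Function.comp_def] using this
  refine Matrix.PosSemidef.of_dotProduct_mulVec_nonneg hY fun x => ?_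
  have hc : Continuous fun q : Matrix ι ι ℂ => star x ⬝ᵥ q *ᵥ x := by fun_prop
  exact ge_of_tendsto' ((hc.tendsto Y).comp hlim) fun k =>
    (hiter k).dotProduct_mulVec_nonneg x

end Lyapunov

/-! ### Rational functions built from a solution of a homogeneous Riccati equation -/

section LosslessRealization

variable {k : Type*} {r : ℕ} [Fintype k] [DecidableEq k]
  {a Y : Matrix (Fin r) (Fin r) ℂ} {c : Matrix k (Fin r) ℂ}

omit [DecidableEq k] in
theorem isControllable_of_homogeneous_riccati (hu : IsUnit Y.det)
    (hric : a * Y + Y * aᴴ + Y * cᴴ * c * Y = 0) (hobs : IsObservable c a) :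
    IsControllable a (Y * cᴴ) := by
  intro z v hva hvc
  have h1 : (v ᵥ* Y) ᵥ* aᴴ = -(z • v ᵥ* Y) := by
    have := congrArg (fun q => v ᵥ* q) hric
    simp only [Matrix.vecMul_add, Matrix.vecMul_zero] at this
    rw [← Matrix.vecMul_vecMul, hva, Matrix.mul_assoc, ← Matrix.vecMul_vecMul v (Y * cᴴ), hvc,
      Matrix.zero_vecMul, add_zero, ← Matrix.vecMul_vecMul, Matrix.smul_vecMul] at this
    rw [eq_neg_iff_add_eq_zero, add_comm, this]
  have h2 : star (v ᵥ* Y) = 0 := by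
    refine hobs (-star z) _ ?_ ?_
    · rw [← star_star (a *ᵥ _), Matrix.star_mulVec, star_star, h1, star_neg, star_smul, neg_smul]
    · rw [← star_star (c *ᵥ _), Matrix.star_mulVec, star_star, Matrix.vecMul_vecMul, hvc,
        star_zero]
  rw [star_eq_zero] at h2
  calc v = (v ᵥ* Y) ᵥ* Y⁻¹ := by
        rw [Matrix.vecMul_vecMul, Matrix.mul_nonsing_inv _ hu, Matrix.vecMul_one]
    _ = 0 := by rw [h2, Matrix.zero_vecMul]

omit [DecidableEq k] in
/-- The Lyapunov equation for `Y⁻¹`, tested on an eigenvector. -/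
theorem eigenvector_identity (hu : IsUnit Y.det)
    (hric : a * Y + Y * aᴴ + Y * cᴴ * c * Y = 0) {z : ℂ} {v : Fin r → ℂ}
    (hv : a *ᵥ v = z • v) :
    (z + star z) * (star v ⬝ᵥ Y⁻¹ *ᵥ v) + star (c *ᵥ v) ⬝ᵥ (c *ᵥ v) = 0 := by
  have hX : Y⁻¹ * a + aᴴ * Y⁻¹ + cᴴ * c = 0 := by
    have h1 := Matrix.mul_nonsing_inv _ hu
    have h2 := Matrix.nonsing_inv_mul _ hu
    calc Y⁻¹ * a + aᴴ * Y⁻¹ + cᴴ * c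
        = Y⁻¹ * a * (Y * Y⁻¹) + (Y⁻¹ * Y) * aᴴ * Y⁻¹ + (Y⁻¹ * Y) * (cᴴ * c) * (Y * Y⁻¹) := by
          rw [h1, h2]; simp
      _ = Y⁻¹ * (a * Y + Y * aᴴ + Y * cᴴ * c * Y) * Y⁻¹ := by
          simp only [Matrix.mul_add, Matrix.add_mul, Matrix.mul_assoc]
      _ = 0 := by rw [hric]; simp
  have h3 := congrArg (fun q => star v ⬝ᵥ q *ᵥ v) hX
  simp only [Matrix.add_mulVec, dotProduct_add, Matrix.zero_mulVec, dotProduct_zero,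
    ← Matrix.mulVec_mulVec] at h3
  rw [hv, Matrix.dotProduct_mulVec _ aᴴ, ← Matrix.star_mulVec, hv,
    Matrix.dotProduct_mulVec _ cᴴ, ← Matrix.star_mulVec, Matrix.mulVec_smul, dotProduct_smul,
    star_smul, smul_dotProduct, smul_eq_mul, smul_eq_mul] at h3
  rw [add_mul, h3]

omit [DecidableEq k] in
theorem charpoly_eval_ne_zero_of_add_star_eq_zero (hu : IsUnit Y.det)
    (hric : a * Y + Y * aᴴ + Y * cᴴ * c * Y = 0) (hobs : IsObservable c a) {z : ℂ}
    (hz : z + star z = 0) : a.charpoly.eval z ≠ 0 := by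
  rw [ne_eq, charpoly_eval_eq_zero_iff]
  rintro ⟨v, hv0, hv⟩
  have h := eigenvector_identity hu hric hv
  rw [hz, zero_mul, zero_add, dotProduct_star_self_eq_zero] at h
  exact hv0 (hobs z v hv h)

omit [DecidableEq k] in
theorem charpoly_eval_ne_zero_of_posDef (hY : Y.PosDef)
    (hric : a * Y + Y * aᴴ + Y * cᴴ * c * Y = 0) {z : ℂ}
    (hz : 0 < z.re) : a.charpoly.eval z ≠ 0 := by
  rw [ne_eq, charpoly_eval_eq_zero_iff]
  rintro ⟨v, hv0, hv⟩
  have h := eigenvector_identity ((Matrix.isUnit_iff_isUnit_det _).1 hY.isUnit) hric hv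
  have h1 := hY.inv.dotProduct_mulVec_pos hv0
  have h2 : 0 ≤ star (c *ᵥ v) ⬝ᵥ (c *ᵥ v) := dotProduct_star_self_nonneg _
  have h3 : 0 < z + star z := by
    rw [Complex.star_def, Complex.add_conj]
    exact_mod_cast mul_pos two_pos hz
  exact (add_pos_of_pos_of_nonneg (mul_pos h3 h1) h2).ne' h

/-- The defect of `1 - c (s - a)⁻¹ Y c*` from being unitary. -/
theorem evalAt_mul_conjTranspose (hY : Y.IsHermitian)
    (hric : a * Y + Y * aᴴ + Y * cᴴ * c * Y = 0) {s : ℂ} (hs : a.charpoly.eval s ≠ 0) :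
    1 - evalAt (transferFunction a (Y * cᴴ) (-c) 1) s *
        (evalAt (transferFunction a (Y * cᴴ) (-c) 1) s)ᴴ =
      (s + star s) • (c * evalAt (pencil a)⁻¹ s * Y * (c * evalAt (pencil a)⁻¹ s)ᴴ) := by
  rw [evalAt_transferFunction hs]
  have h1 := mul_eq_one_comm.1 (scalar_sub_mul_evalAt_inv_pencil hs)
  set ρ := evalAt (pencil a)⁻¹ s
  have hsc : Matrix.scalar (Fin r) s = s • (1 : Matrix (Fin r) (Fin r) ℂ) := by
    rw [Matrix.scalar_apply, Matrix.smul_one_eq_diagonal]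
  rw [hsc] at h1
  have h2 : (star s • (1 : Matrix (Fin r) (Fin r) ℂ) - aᴴ) * ρᴴ = 1 := by
    have := congrArg Matrix.conjTranspose h1
    simpa [Matrix.conjTranspose_mul, Matrix.conjTranspose_smul] using this
  have h3 : Y * cᴴ * c * Y = (s • 1 - a) * Y + Y * (star s • 1 - aᴴ) - (s + star s) • Y := by
    rw [← sub_eq_zero, ← hric]
    simp only [Matrix.sub_mul, Matrix.mul_sub, Matrix.smul_mul, Matrix.mul_smul, Matrix.one_mul,
      Matrix.mul_one, add_smul]
    abel
  have h4 : ρ * (Y * cᴴ * c * Y) * ρᴴ = Y * ρᴴ + ρ * Y - (s + star s) • (ρ * Y * ρᴴ) := by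
    rw [h3, Matrix.mul_sub, Matrix.sub_mul, Matrix.mul_add, Matrix.add_mul,
      ← Matrix.mul_assoc ρ _ Y, h1, Matrix.one_mul, ← Matrix.mul_assoc ρ Y,
      Matrix.mul_assoc (ρ * Y), h2, Matrix.mul_one, Matrix.mul_smul, Matrix.smul_mul]
  have h5 : c * (ρ * (Y * cᴴ * c * Y) * ρᴴ) * cᴴ =
      c * Y * ρᴴ * cᴴ + c * ρ * Y * cᴴ - (s + star s) • (c * ρ * Y * ρᴴ * cᴴ) := by
    rw [h4]
    simp only [Matrix.mul_sub, Matrix.sub_mul, Matrix.mul_add, Matrix.add_mul, Matrix.mul_smul,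
      Matrix.smul_mul, Matrix.mul_assoc]
  simp only [Matrix.conjTranspose_add, Matrix.conjTranspose_mul, Matrix.conjTranspose_neg,
    Matrix.conjTranspose_one, Matrix.conjTranspose_conjTranspose, hY.eq, Matrix.mul_add,
    Matrix.add_mul, Matrix.neg_mul, Matrix.mul_neg, Matrix.mul_one, Matrix.one_mul]
  simp only [← Matrix.mul_assoc] at h5 ⊢
  rw [h5]
  abel

theorem unitaryOnImaginaryAxis_of_homogeneous_riccati (hY : Y.IsHermitian) (hu : IsUnit Y.det)
    (hric : a * Y + Y * aᴴ + Y * cᴴ * c * Y = 0) (hobs : IsObservable c a) :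
    UnitaryOnImaginaryAxis (transferFunction a (Y * cᴴ) (-c) 1) := by
  intro ω
  have hz : Complex.I * ω + star (Complex.I * ω) = 0 := by simp
  have hs := charpoly_eval_ne_zero_of_add_star_eq_zero hu hric hobs hz
  refine ⟨regularAt_transferFunction hs _ _ _, ?_⟩
  have h := evalAt_mul_conjTranspose hY hric hs
  rw [hz, zero_smul, sub_eq_zero] at h
  exact h.symm

theorem isInner_iff_of_homogeneous_riccati (hY : Y.IsHermitian) (hu : IsUnit Y.det)
    (hric : a * Y + Y * aᴴ + Y * cᴴ * c * Y = 0) (hobs : IsObservable c a) :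
    IsInner (transferFunction a (Y * cᴴ) (-c) 1) ↔ Y.PosSemidef := by
  constructor
  · intro h
    have hctrl := isControllable_of_homogeneous_riccati hu hric hobs
    have hobs' : IsObservable (-c) a := fun z v h1 h2 =>
      hobs z v h1 (by rwa [Matrix.neg_mulVec, neg_eq_zero] at h2)
    refine posSemidef_of_lyapunov (a := a) hY (fun z v hv hav => ?_) ?_
    · have h0 : a.charpoly.eval z = 0 := (charpoly_eval_eq_zero_iff a).2 ⟨v, hv, hav⟩
      rcases lt_trichotomy z.re 0 with hz | hz | hz
      · exact hz
      · refine absurd h0 (charpoly_eval_ne_zero_of_add_star_eq_zero hu hric hobs ?_)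
        rw [Complex.star_def, Complex.add_conj, hz]
        simp
      · exact absurd h0 (charpoly_eval_ne_zero_of_regularAt hobs' hctrl (h.1 z hz).1)
    · have h1 : -(a * Y + Y * aᴴ) = (c * Y)ᴴ * (c * Y) := by
        rw [eq_comm, Matrix.conjTranspose_mul, hY.eq, ← sub_eq_zero, ← hric]
        simp only [Matrix.mul_assoc]
        abel
      rw [h1]
      exact Matrix.posSemidef_conjTranspose_mul_self _
  · intro h
    have hpd : Y.PosDef := h.posDef_iff_isUnit.2 ((Matrix.isUnit_iff_isUnit_det _).2 hu)
    refine ⟨fun s hs => ?_, unitaryOnImaginaryAxis_of_homogeneous_riccati hY hu hric hobs⟩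
    have hs' := charpoly_eval_ne_zero_of_posDef hpd hric hs
    refine ⟨regularAt_transferFunction hs' _ _ _, ?_⟩
    rw [Matrix.le_iff, evalAt_mul_conjTranspose hY hric hs']
    refine (h.mul_mul_conjTranspose_same _).smul ?_
    rw [Complex.star_def, Complex.add_conj]
    exact_mod_cast (mul_pos two_pos hs).le

end LosslessRealization

/-! ### Reduction to the range of a solution -/

/-- Compact spectral decomposition: only the eigenvectors for nonzero eigenvalues are kept. -/
theorem exists_compact_spectral_decomposition {n : ℕ} {H : Matrix (Fin n) (Fin n) ℂ}
    (hH : H.IsHermitian) {r : ℕ} (hr : H.rank = r) :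
    ∃ (U : Matrix (Fin n) (Fin r) ℂ) (Y : Matrix (Fin r) (Fin r) ℂ),
      Uᴴ * U = 1 ∧ Y.IsHermitian ∧ IsUnit Y.det ∧ H = U * Y * Uᴴ := by
  classical
  obtain ⟨e⟩ : Nonempty (Fin r ≃ {i // hH.eigenvalues i ≠ 0}) :=
    ⟨Fintype.equivOfCardEq (by rw [Fintype.card_fin, ← hr, hH.rank_eq_card_non_zero_eigs])⟩
  let V : Matrix (Fin n) (Fin n) ℂ := hH.eigenvectorUnitary
  have hV : Vᴴ * V = 1 := Unitary.coe_star_mul_self hH.eigenvectorUnitary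
  have hspec : H = V * Matrix.diagonal (RCLike.ofReal ∘ hH.eigenvalues) * Vᴴ := by
    conv_lhs => rw [hH.spectral_theorem, Unitary.conjStarAlgAut_apply]
    rfl
  refine ⟨V.submatrix id fun x => (e x).1,
    Matrix.diagonal fun x => (hH.eigenvalues (e x).1 : ℂ), ?_, ?_, ?_, ?_⟩
  · have h : (V.submatrix id fun x => (e x).1)ᴴ * V.submatrix id (fun x => (e x).1) =
        (Vᴴ * V).submatrix (fun x => (e x).1) fun x => (e x).1 := rfl
    rw [h, hV, Matrix.submatrix_one (fun x => (e x).1) (Subtype.val_injective.comp e.injective)]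
  · rw [Matrix.IsHermitian, Matrix.diagonal_conjTranspose]
    congr 1
    ext x
    simp
  · rw [Matrix.det_diagonal, isUnit_iff_ne_zero, Finset.prod_ne_zero_iff]
    intro x _
    exact_mod_cast (e x).2
  · conv_lhs => rw [hspec]
    ext i j
    rw [Matrix.mul_apply, Matrix.mul_apply]
    simp only [Matrix.mul_diagonal, Matrix.conjTranspose_apply, Matrix.submatrix_apply, id,
      Function.comp_apply]
    refine (Finset.sum_of_injOn (fun x => (e x).1)
      (Subtype.val_injective.comp e.injective).injOn (fun _ _ => by simp) (fun y _ hy => ?_)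
      fun _ _ => rfl).symm
    have h0 : hH.eigenvalues y = 0 := by
      by_contra h
      exact hy ⟨e.symm ⟨y, h⟩, by simp⟩
    simp [h0]

section HomogeneousRiccati

variable {n p : ℕ} {F Δ : Matrix (Fin n) (Fin n) ℂ} {H : Matrix (Fin p) (Fin n) ℂ}

/-- The range of `Δ` is invariant under `F`; restricted to it, the solution `Δ` becomes
invertible and the realization minimal. -/
theorem homogeneous_riccati_properties (hΔ : Δ.IsHermitian)
    (hric : F * Δ + Δ * Fᴴ + Δ * Hᴴ * H * Δ = 0) (hobs : IsObservable H F)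
    {Q : Matrix (Fin p) (Fin p) (RatFunc ℂ)} (hQ : Q = transferFunction F (Δ * Hᴴ) (-H) 1) :
    UnitaryOnImaginaryAxis Q ∧ HasMcMillanDegree Q Δ.rank ∧ (IsInner Q ↔ Δ.PosSemidef) := by
  obtain ⟨r, hr⟩ : ∃ r, Δ.rank = r := ⟨_, rfl⟩
  obtain ⟨U, Y, hU, hY, hu, hUY⟩ := exists_compact_spectral_decomposition hΔ hr
  have hΔU : Δ * U = U * Y := by
    conv_lhs => rw [hUY]
    rw [Matrix.mul_assoc, hU, Matrix.mul_one]
  have hUΔ : Uᴴ * Δ = Y * Uᴴ := by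
    conv_lhs => rw [hUY]
    rw [← Matrix.mul_assoc, ← Matrix.mul_assoc, hU, Matrix.one_mul]
  have hYU : Uᴴ * Δ * U = Y := by rw [hUΔ, Matrix.mul_assoc, hU, Matrix.mul_one]
  have hFU : F * U = U * (Uᴴ * F * U) := by
    have h1 : F * U = U * (-(Y * Uᴴ * (Fᴴ + Hᴴ * H * Δ) * U * Y⁻¹)) := by
      have h2 : F * Δ = -(Δ * (Fᴴ + Hᴴ * H * Δ)) := by
        rw [eq_neg_iff_add_eq_zero, ← hric, Matrix.mul_add, ← Matrix.mul_assoc,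
          ← Matrix.mul_assoc, add_assoc]
      calc F * U = F * (Δ * U) * Y⁻¹ := by
            rw [hΔU, Matrix.mul_assoc, Matrix.mul_assoc U, Matrix.mul_nonsing_inv _ hu,
              Matrix.mul_one]
        _ = -(Δ * (Fᴴ + Hᴴ * H * Δ)) * U * Y⁻¹ := by rw [← Matrix.mul_assoc, h2]
        _ = -(U * Y * Uᴴ * (Fᴴ + Hᴴ * H * Δ)) * U * Y⁻¹ := by rw [← hUY]
        _ = _ := by simp only [Matrix.neg_mul, Matrix.mul_neg, Matrix.mul_assoc]
    have h2 : Uᴴ * F * U = -(Y * Uᴴ * (Fᴴ + Hᴴ * H * Δ) * U * Y⁻¹) := by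
      rw [Matrix.mul_assoc, h1, ← Matrix.mul_assoc, hU, Matrix.one_mul]
    rw [h2, h1]
  set a := Uᴴ * F * U with ha
  set c := H * U with hc
  have hric' : a * Y + Y * aᴴ + Y * cᴴ * c * Y = 0 := by
    have h1 : Uᴴ * (F * Δ + Δ * Fᴴ + Δ * Hᴴ * H * Δ) * U = 0 := by rw [hric]; simp
    rw [← h1]
    calc a * Y + Y * aᴴ + Y * cᴴ * c * Y
        = Uᴴ * F * (U * Y) + (Y * Uᴴ) * Fᴴ * U + (Y * Uᴴ) * Hᴴ * H * (U * Y) := by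
          simp only [ha, hc, Matrix.conjTranspose_mul, Matrix.conjTranspose_conjTranspose,
            Matrix.mul_assoc]
      _ = _ := by
          rw [← hΔU, ← hUΔ]
          simp only [Matrix.mul_add, Matrix.add_mul, Matrix.mul_assoc]
  have hobs' : IsObservable c a := by
    intro z v hav hcv
    have h1 : U *ᵥ v = 0 := by
      refine hobs z _ ?_ (by rw [Matrix.mulVec_mulVec, ← hc, hcv])
      rw [Matrix.mulVec_mulVec, hFU, ← Matrix.mulVec_mulVec, hav, Matrix.mulVec_smul]
    rw [← Matrix.one_mulVec v, ← hU, ← Matrix.mulVec_mulVec, h1, Matrix.mulVec_zero]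
  have hobs_neg : IsObservable (-c) a := fun z v h1 h2 =>
    hobs' z v h1 (by rwa [Matrix.neg_mulVec, neg_eq_zero] at h2)
  have hQ' : Q = transferFunction a (Y * cᴴ) (-c) 1 := by
    have h1 : Δ * Hᴴ = U * (Y * cᴴ) := by
      rw [hc, Matrix.conjTranspose_mul, ← Matrix.mul_assoc, ← Matrix.mul_assoc, ← hUY]
    rw [hQ, h1, transferFunction_of_intertwine hFU, Matrix.neg_mul]
  have hpsd : Δ.PosSemidef ↔ Y.PosSemidef := by
    constructor
    · intro h
      rw [← hYU]
      exact h.conjTranspose_mul_mul_same U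
    · intro h
      rw [hUY]
      exact h.mul_mul_conjTranspose_same U
  rw [hpsd, hQ', hr]
  exact ⟨unitaryOnImaginaryAxis_of_homogeneous_riccati hY hu hric' hobs',
    hasMcMillanDegree_of_isObservable_isControllable hobs_neg
      (isControllable_of_homogeneous_riccati hu hric' hobs'),
    isInner_iff_of_homogeneous_riccati hY hu hric' hobs'⟩

end HomogeneousRiccati

/-! ### The block `S₂₁` and the quotient of two such blocks -/

section Quotient

variable {n p : ℕ} {A : Matrix (Fin n) (Fin n) ℂ} {B : Matrix (Fin n) (Fin p) ℂ}
  {C : Matrix (Fin p) (Fin n) ℂ} {D : Matrix (Fin p) (Fin p) ℂ}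

open scoped Matrix.Norms.L2Operator in
theorem norm_mul_conjTranspose_lt_one (hD : ‖Matrix.toEuclideanCLM (𝕜 := ℂ) D‖ < 1) :
    ‖D * Dᴴ‖ < 1 := by
  rw [← Matrix.cstar_norm_def] at hD
  calc ‖D * Dᴴ‖ ≤ ‖D‖ * ‖Dᴴ‖ := norm_mul_le _ _
    _ = ‖D‖ * ‖D‖ := by rw [Matrix.l2_opNorm_conjTranspose]
    _ < 1 := mul_lt_one_of_nonneg_of_lt_one_left (norm_nonneg _) hD hD.le

open scoped Matrix.Norms.L2Operator in
theorem isUnit_one_sub_mul_conjTranspose (hD : ‖Matrix.toEuclideanCLM (𝕜 := ℂ) D‖ < 1) :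
    IsUnit (1 - D * Dᴴ) :=
  isUnit_one_sub_of_norm_lt_one (norm_mul_conjTranspose_lt_one hD)

open scoped Matrix.Norms.L2Operator in
theorem one_sub_mul_conjTranspose_nonneg (hD : ‖Matrix.toEuclideanCLM (𝕜 := ℂ) D‖ < 1) :
    0 ≤ 1 - D * Dᴴ :=
  sub_nonneg.2 ((CStarAlgebra.norm_le_one_iff_of_nonneg _ (mul_star_self_nonneg D)).1
    (norm_mul_conjTranspose_lt_one hD).le)

theorem isHermitian_D21 : (D21 D).IsHermitian :=
  (Matrix.nonneg_iff_posSemidef.1 (CFC.sqrt_nonneg _)).1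

theorem D21_mul_self (hD : ‖Matrix.toEuclideanCLM (𝕜 := ℂ) D‖ < 1) :
    D21 D * D21 D = 1 - D * Dᴴ :=
  CFC.sqrt_mul_sqrt_self _ (one_sub_mul_conjTranspose_nonneg hD)

theorem isUnit_det_D21 (hD : ‖Matrix.toEuclideanCLM (𝕜 := ℂ) D‖ < 1) : IsUnit (D21 D).det := by
  have h := (Matrix.isUnit_iff_isUnit_det _).1 (isUnit_one_sub_mul_conjTranspose hD)
  rw [← D21_mul_self hD, Matrix.det_mul] at h
  exact isUnit_of_mul_isUnit_left h

theorem S21_eq_transferFunction (P : Matrix (Fin n) (Fin n) ℂ) :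
    S21 A B C D P = transferFunction A (B1 B C D P) C (D21 D) := by
  ext i j
  simp [S21, extension, transferFunction, Matrix.toBlocks₂₁, Matrix.mul_apply]

/-- Multiplication of `(C R G + E) E⁻¹ C` with the resolvent of `A - G E⁻¹ C` cancels its pencil,
since `(C R G + E) E⁻¹ C = C R (X I - (A - G E⁻¹ C))`. -/
theorem transferFunction_mul_resolvent {E : Matrix (Fin p) (Fin p) ℂ} (hE : IsUnit E.det)
    (G : Matrix (Fin n) (Fin p) ℂ) :
    transferFunction A G C E * (E⁻¹ * C).map RatFunc.C * (pencil (A - G * E⁻¹ * C))⁻¹ =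
      C.map RatFunc.C * (pencil A)⁻¹ := by
  have h1 : pencil (A - G * E⁻¹ * C) =
      pencil A + G.map RatFunc.C * (E⁻¹ * C).map RatFunc.C := by
    rw [← Matrix.map_mul, pencil, pencil, ← Matrix.mul_assoc,
      Matrix.map_sub _ (map_sub RatFunc.C)]
    abel
  have h2 : E.map (RatFunc.C : ℂ →+* RatFunc ℂ) * (E⁻¹ * C).map RatFunc.C =
      C.map RatFunc.C := by
    rw [← Matrix.map_mul, Matrix.mul_nonsing_inv_cancel_left _ _ hE]
  have h3 : transferFunction A G C E * (E⁻¹ * C).map RatFunc.C =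
      C.map RatFunc.C * (pencil A)⁻¹ * pencil (A - G * E⁻¹ * C) := by
    rw [h1, transferFunction_eq, Matrix.add_mul, h2, Matrix.mul_add,
      Matrix.mul_assoc _ (pencil A)⁻¹ (pencil A), inv_mul_pencil, Matrix.mul_one,
      Matrix.mul_assoc _ (G.map _), add_comm]
  rw [h3, Matrix.mul_assoc, pencil_mul_inv, Matrix.mul_one]

/-- Quotients of transfer functions that differ only in the input matrix. -/
theorem transferFunction_mul_quotient {E : Matrix (Fin p) (Fin p) ℂ} (hE : IsUnit E.det)
    (G K : Matrix (Fin n) (Fin p) ℂ) :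
    transferFunction A G C E *
      transferFunction (A - G * E⁻¹ * C) K (E⁻¹ * C) 1 = transferFunction A (G + K) C E := by
  rw [transferFunction_eq (A - G * E⁻¹ * C), Matrix.mul_add, ← Matrix.mul_assoc,
    ← Matrix.mul_assoc, transferFunction_mul_resolvent hE,
    Matrix.map_one _ (map_zero RatFunc.C) (map_one RatFunc.C), Matrix.mul_one,
    transferFunction_eq, transferFunction_eq, Matrix.map_add _ (map_add RatFunc.C),
    Matrix.mul_add]
  abel

/-- A transfer function with invertible value at infinity is invertible: the quotient with
`K = -G` gives the constant `E`. -/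
theorem isUnit_transferFunction {E : Matrix (Fin p) (Fin p) ℂ} (hE : IsUnit E.det)
    (G : Matrix (Fin n) (Fin p) ℂ) : IsUnit (transferFunction A G C E) := by
  have h := transferFunction_mul_quotient (A := A) (C := C) hE G (-G)
  have h0 : transferFunction A (G + -G) C E = E.map RatFunc.C := by
    rw [transferFunction_eq, add_neg_cancel, Matrix.map_zero _ (map_zero RatFunc.C),
      Matrix.mul_zero, zero_add]
  refine IsUnit.of_mul_eq_one
    (transferFunction (A - G * E⁻¹ * C) (-G) (E⁻¹ * C) 1 * E⁻¹.map RatFunc.C) ?_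
  rw [← Matrix.mul_assoc, h, h0, ← Matrix.map_mul, Matrix.mul_nonsing_inv _ hE,
    Matrix.map_one _ (map_zero RatFunc.C) (map_one RatFunc.C)]

/-- The dynamics matrix of the inverse of `S₂₁`. -/
theorem dynamics_inverse_S21 (hD : ‖Matrix.toEuclideanCLM (𝕜 := ℂ) D‖ < 1)
    (P : Matrix (Fin n) (Fin n) ℂ) :
    A - B1 B C D P * (D21 D)⁻¹ * C = hatA A B C D + P * (hatC C D)ᴴ * hatC C D := by
  have hinv : (D21 D)⁻¹ᴴ = (D21 D)⁻¹ := by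
    rw [Matrix.conjTranspose_nonsing_inv, isHermitian_D21.eq]
  have hC : hatC C D = (D21 D)⁻¹ * C := rfl
  rw [hatA, ← D21_mul_self hD, Matrix.mul_inv_rev, hC, Matrix.conjTranspose_mul, hinv, B1]
  simp only [Matrix.add_mul, Matrix.neg_mul, Matrix.mul_assoc, sub_neg_eq_add]
  abel

/-- The difference of two solutions solves a homogeneous Riccati equation. -/
theorem riccati_difference {P Pt : Matrix (Fin n) (Fin n) ℂ}
    (hP : IsRiccatiSolution A B C D P) (hPt : IsRiccatiSolution A B C D Pt) :
    (hatA A B C D + P * (hatC C D)ᴴ * hatC C D) * (Pt - P) +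
      (Pt - P) * (hatA A B C D + P * (hatC C D)ᴴ * hatC C D)ᴴ +
      (Pt - P) * (hatC C D)ᴴ * hatC C D * (Pt - P) = 0 := by
  have h := sub_eq_zero.2 (hPt.2.trans hP.2.symm)
  rw [← h]
  simp only [Matrix.conjTranspose_add, Matrix.conjTranspose_mul,
    Matrix.conjTranspose_conjTranspose, hP.1.eq, Matrix.mul_add, Matrix.add_mul, Matrix.mul_sub,
    Matrix.sub_mul, Matrix.mul_assoc]
  abel

end Quotient

end Darlington

theorem proposition4p1 {n p : ℕ} (S : Matrix (Fin p) (Fin p) (RatFunc ℂ))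
    (A : Matrix (Fin n) (Fin n) ℂ) (B : Matrix (Fin n) (Fin p) ℂ)
    (C : Matrix (Fin p) (Fin n) ℂ) (D : Matrix (Fin p) (Fin p) ℂ)
    (hS : Darlington.IsSchur S)
    (hreal : Darlington.IsMinimalRealization A B C D S)
    -- `D = S(∞)` is strictly contractive for the operator norm
    (hD : ‖Matrix.toEuclideanCLM (𝕜 := ℂ) D‖ < 1)
    (P Pt : Matrix (Fin n) (Fin n) ℂ)
    (hP : Darlington.IsRiccatiSolution A B C D P)
    (hPt : Darlington.IsRiccatiSolution A B C D Pt)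
    (hne : P ≠ Pt)
    (Q : Matrix (Fin p) (Fin p) (RatFunc ℂ))
    (hQ : Q = (Darlington.S21 A B C D P)⁻¹ * Darlington.S21 A B C D Pt) :
    IsUnit (Darlington.S21 A B C D P) ∧
      Darlington.UnitaryOnImaginaryAxis Q ∧
      Darlington.HasMcMillanDegree Q (Pt - P).rank ∧
      (Darlington.IsInner Q ↔ P ≤ Pt) := by
  open Darlington in
  have hE := isUnit_det_D21 hD
  have hEinv : (D21 D)⁻¹ᴴ = (D21 D)⁻¹ := by
    rw [Matrix.conjTranspose_nonsing_inv, isHermitian_D21.eq]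
  have hC : hatC C D = (D21 D)⁻¹ * C := rfl
  have hunit : IsUnit (S21 A B C D P) := by
    rw [S21_eq_transferFunction]
    exact isUnit_transferFunction hE _
  refine ⟨hunit, ?_⟩
  rw [Matrix.le_iff]
  refine homogeneous_riccati_properties (hPt.1.sub hP.1) (riccati_difference hP hPt) ?_ ?_
  · -- observability is invariant under output injection
    intro z v h1 h2
    have hCv : C *ᵥ v = 0 := by
      rw [hC, ← Matrix.mulVec_mulVec] at h2
      rw [← Matrix.one_mulVec (C *ᵥ v), ← Matrix.mul_nonsing_inv _ hE, ← Matrix.mulVec_mulVec, h2,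
        Matrix.mulVec_zero]
    refine hreal.isObservable z v ?_ hCv
    rwa [← dynamics_inverse_S21 hD, Matrix.sub_mulVec, ← Matrix.mulVec_mulVec, hCv,
      Matrix.mulVec_zero, sub_zero] at h1
  · have hB1 : B1 B C D Pt = B1 B C D P + -((Pt - P) * (hatC C D)ᴴ) := by
      rw [hC, Matrix.conjTranspose_mul, hEinv, B1, B1]
      simp only [Matrix.sub_mul, Matrix.add_mul, Matrix.mul_assoc]
      abel
    rw [hQ, S21_eq_transferFunction Pt, hB1, ← transferFunction_mul_quotient hE,
      ← S21_eq_transferFunction,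
      Matrix.nonsing_inv_mul_cancel_left _ _ ((Matrix.isUnit_iff_isUnit_det _).1 hunit),
      dynamics_inverse_S21 hD, ← hC, transferFunction_eq, transferFunction_eq]
    congr 1
    have h1 : ∀ {k m : Type} (M : Matrix k m ℂ),
        (-M).map (RatFunc.C : ℂ →+* RatFunc ℂ) = -M.map RatFunc.C := by
      intros; ext; simp
    rw [h1, h1, Matrix.mul_neg, Matrix.neg_mul, Matrix.neg_mul]
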